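/- Let $\Omega>0$, $n\ge 2$, $T\in\mathbb N$, $c_0\ge 1$, and let $\mathcal O\subset\mathbb R^2$ be a closed disk of radius $\frac{c_0 n\pi}{\Omega}$. Let $\mu=\sum_{j=1}^n a_j\delta_{\mathbf y_j}$ with distinct points $\mathbf y_j\in\mathcal O$ and nonzero amplitudes $a_j\in\mathbb C$, and put $$m_{\min}=\min_{j}|a_j|,\qquad d_{\min}=\min_{p\ne j}\|\mathbf y_p-\mathbf y_j\|_2 .$$ For a discrete measure $\rho=\sum_{j=1}^k b_j\delta_{\mathbf z_j}$ (distinct $\mathbf z_j\in\mathbb R^2$, nonzero $b_j\in\mathbb C$) let $\|\rho\|_0=k$ be the number of its Dirac masses, and for a function $J:\mathbb R^2\to\mathbb C$ let $J\rho=\sum_j J(\mathbf z_j)b_j\delta_{\mathbf z_j}$ and $\mathcal F[J\rho](\boldsymbol\omega)=\sum_{j}J(\mathbf z_j)b_j e^{i\mathbf z_j\cdot\boldsymbol\omega}$. Write $\|f\|_\infty=\sup_{\|\boldsymbol\omega\|_2\le\Omega}|f(\boldsymbol\omega)|$. Let $I_1,\dots,I_T:\mathbb R^2\to\mathbb C$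 be illumination patterns and let the measurements be $$\mathbf Y_t(\boldsymbol\omega)=\mathcal F[I_t\mu](\boldsymbol\omega)+\mathbf W_t(\boldsymbol\omega),\qquad \|\boldsymbol\omega\|_2\le\Omega,\quad 1\le t\le T,$$ with noise satisfying $\|\mathbf W_t\|_\infty<\sigma$. Let $I=(I_t(\mathbf y_j))_{1\le t\le T,\,1\le j\le n}$ be the illumination matrix and $$\sigma_{\infty,\min}(I)=\min_{x\in\mathbb C^n,\ \|x\|_\infty\ge 1}\|Ix\|_\infty ,$$ which is assumed to be positive. Assume the separation condition $$d_{\min}\ \ge\ \frac{2.2\,c_0e\pi(n+2)(n+1)}{\Omega}\Big(\frac{1}{\sigma_{\infty,\min}(I)}\frac{\sigma}{m_{\min}}\Big)^{1/n}.$$ Consider the three problems of minimizing $\|\rho\|_0$ over the discrete measures $\rho$ supported in $\mathcal O$ subject to, respectively, 1. (known patterns) $\|\mathcal F[I_t\rho]-\mathbf Y_t\|_\infty<\sigma$ for all $1\le t\le T$; 2. (approximate patterns) $\|\mathcal F[\hat I_t\rho]-\mathbf Y_t\|_\infty<\sigma$ for all $1\le t\le T$, where $\hat I_1,\dots,\hat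 I_T:\mathbb R^2\to\mathbb C$ are given functions for which some measure with exactly $n$ Dirac masses is feasible; 3. (unknown patterns) there exist functions $\hat I_1,\dots,\hat I_T:\mathbb R^2\to\mathbb C$ with $\|\mathcal F[\hat I_t\rho]-\mathbf Y_t\|_\infty<\sigma$ for all $1\le t\le T$. Then every solution $\rho$ of any of these three problems has exactly $n$ Dirac masses, and its points can be numbered $\hat{\mathbf y}_1,\dots,\hat{\mathbf y}_n$ so that, for all $1\le j\le n$, $$\|\hat{\mathbf y}_j-\mathbf y_j\|_2<\frac{d_{\min}}2\qquad\text{and}\qquad \|\hat{\mathbf y}_j-\mathbf y_j\|_2<\frac{C(n)}{\Omega}\,\mathrm{SRF}^{\,n-1}\,\frac{1}{\sigma_{\infty,\min}(I)}\frac{\sigma}{m_{\min}},$$ where $C(n)=(n+1)^n(n+2)^n\sqrt{2\pi}\,n\,c_0^{\,n-1}e^n$ and $\mathrm{SRF}=\frac{\pi}{\Omega d_{\min}}$. -/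

import Mathlib

namespace MultiIllum

noncomputable section

/-- The Euclidean plane. -/
abbrev Plane : Type := EuclideanSpace ℝ (Fin 2)

/-- A discrete (finite, complex) measure on the plane: the function `ρ` with finite support
stands for the measure with mass `ρ y` at each point `y` of its support, i.e. the sum of the
Dirac masses `ρ y • δ_y` with nonzero amplitudes. -/
abbrev DiscreteMeasure : Type := Plane →₀ ℂ

/-- The number of Dirac masses of a discrete measure. -/
def l0 (ρ : DiscreteMeasure) : ℕ := ρ.support.card

/-- The measure with masses `a j` at the points `y j`. -/
def ofPoints {n : ℕ} (y : Fin n → Plane) (a : Fin n → ℂ) : DiscreteMeasure :=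
  ∑ j, Finsupp.single (y j) (a j)

/-- The discrete measure `ρ` illuminated by the pattern `J`: the mass `ρ y` at `y` becomes
`J y * ρ y`. -/
def illuminate (J : Plane → ℂ) (ρ : DiscreteMeasure) : DiscreteMeasure :=
  Finsupp.onFinset ρ.support (fun y => J y * ρ y) fun y hy => by
    rw [Finsupp.mem_support_iff]
    exact right_ne_zero_of_mul hy

/-- The Fourier transform of a discrete measure, with the convention
`δ_y ↦ exp (i y · ω)`. -/
def fourierData (ρ : DiscreteMeasure) (ω : Plane) : ℂ :=
  ρ.sum fun y a => a * Complex.exp (Complex.I * ((inner ℝ y ω : ℝ) : ℂ))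

/-- The supremum norm over the disk `‖ω‖ ≤ Ω` (infinite if `f` is unbounded there). -/
def supNorm (Ω : ℝ) (f : Plane → ℂ) : ENNReal :=
  ⨆ ω ∈ Metric.closedBall (0 : Plane) Ω, ‖f ω‖ₑ

/-- `σ_{∞,min}(A)`: the minimum of `‖A x‖_∞` over complex vectors `x` with `‖x‖_∞ ≥ 1`
(the norm of a function on `Fin k` is the maximum norm). -/
def sigmaInftyMin {m k : ℕ} (A : Matrix (Fin m) (Fin k) ℂ) : ℝ :=
  sInf ((fun x : Fin k → ℂ => ‖A.mulVec x‖) '' {x | 1 ≤ ‖x‖})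

/-- The illumination matrix, with entries `I_t (y_j)`. -/
def illuminationMatrix {T n : ℕ} (J : Fin T → Plane → ℂ) (y : Fin n → Plane) :
    Matrix (Fin T) (Fin n) ℂ :=
  Matrix.of fun t j => J t (y j)

/-- The minimal modulus of the amplitudes. -/
def mMin {n : ℕ} (a : Fin n → ℂ) : ℝ := ⨅ j, ‖a j‖

/-- The minimal Euclidean distance between two of the points with different indices. -/
def dMin {n : ℕ} (y : Fin n → Plane) : ℝ :=
  ⨅ p : {p : Fin n × Fin n // p.1 ≠ p.2}, dist (y p.1.1) (y p.1.2)

/-- The super-resolution factor. -/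
def srf (Ω d : ℝ) : ℝ := Real.pi / (Ω * d)

/-- The constant `C(n) = (n+1)^n (n+2)^n √(2π) n c₀^(n-1) e^n`. -/
def constC (n : ℕ) (c₀ : ℝ) : ℝ :=
  ((n : ℝ) + 1) ^ n * ((n : ℝ) + 2) ^ n * Real.sqrt (2 * Real.pi) * n * c₀ ^ (n - 1)
    * Real.exp 1 ^ n

/-- The discrete measures supported in `O` that satisfy the measurement constraints
`‖F[J_t ρ] - Y_t‖_∞ < σ` for all `t`. -/
def feasible (Ω σ : ℝ) (O : Set Plane) {T : ℕ} (Y J : Fin T → Plane → ℂ) :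
    Set DiscreteMeasure :=
  {ρ | (ρ.support : Set Plane) ⊆ O ∧
    ∀ t, supNorm Ω (fun ω => fourierData (illuminate (J t) ρ) ω - Y t ω) < ENNReal.ofReal σ}

/-- `ρ` is a solution of the `l0`-minimization problem with feasible set `S`. -/
def IsSparsest (S : Set DiscreteMeasure) (ρ : DiscreteMeasure) : Prop :=
  ρ ∈ S ∧ ∀ ρ' ∈ S, l0 ρ ≤ l0 ρ'

/-- Solutions when the illumination patterns `J` are known. -/
def SolvesKnown (Ω σ : ℝ) (O : Set Plane) {T : ℕ} (Y J : Fin T → Plane → ℂ)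
    (ρ : DiscreteMeasure) : Prop :=
  IsSparsest (feasible Ω σ O Y J) ρ

/-- Solutions for approximate illumination patterns `Jhat`, which have to be such that the
feasible set contains some measure with `n` Dirac masses. -/
def SolvesApprox (n : ℕ) (Ω σ : ℝ) (O : Set Plane) {T : ℕ} (Y Jhat : Fin T → Plane → ℂ)
    (ρ : DiscreteMeasure) : Prop :=
  (∃ ρ' ∈ feasible Ω σ O Y Jhat, l0 ρ' = n) ∧ IsSparsest (feasible Ω σ O Y Jhat) ρ

/-- Solutions when the illumination patterns are completely unknown. -/
def SolvesUnknown (Ω σ : ℝ) (O : Set Plane) {T : ℕ} (Y : Fin T → Plane → ℂ)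
    (ρ : DiscreteMeasure) : Prop :=
  IsSparsest {ρ' | ∃ Jhat : Fin T → Plane → ℂ, ρ' ∈ feasible Ω σ O Y Jhat} ρ

end

end MultiIllum

open MultiIllum

namespace MultiIllum

open Finset

/-! The unknown patterns are eliminated by annihilation. A candidate `ρ` has at most `n` atoms, and
its data differ from the true data by less than `2σ` on the disk of radius `Ω`. Fix `j` and weight
amplitudes by `w p = ∏ sin (v z · (p - z))` over the atoms `z` of `ρ`. Each sine averages two
translates of the Fourier transform by `± v z`; if `‖v z‖ ≤ Ω / n`, all translates of the origin
stay in the disk and the `2σ` bound survives. Since `w` vanishes on the support of `ρ`, that measure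
drops out whatever its patterns, leaving `|∑ i, I_t (y i) * a i * w (y i)| < 2σ` for every `t`. Then
`σ_{∞,min}` bounds `|w (y j)|`, and aligning `v z` with `y j - z` turns this into a product bound on
the distances `‖y j - z‖` (`prod_min_dist_lt`).

Under the separation condition this product is too small for every `z` to be at distance at least `d
/ 2` from `y j`. So each `y j` has its own atom, counting makes this a bijection, and dividing by
the `n - 1` factors of the other atoms gives the error bound (`exists_matching`). -/

lemma illuminate_apply (J : Plane → ℂ) (ρ : DiscreteMeasure) (p : Plane) :
    illuminate J ρ p = J p * ρ p := rfl

lemma fourierData_eq_linearCombination (ρ : DiscreteMeasure) (ω : Plane) :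
    fourierData ρ ω =
      Finsupp.linearCombination ℂ
        (fun p : Plane => Complex.exp (Complex.I * ((inner ℝ p ω : ℝ) : ℂ))) ρ := rfl

lemma illuminate_ofPoints {n : ℕ} (J : Plane → ℂ) (y : Fin n → Plane) (a : Fin n → ℂ) :
    illuminate J (ofPoints y a) = ∑ j, Finsupp.single (y j) (J (y j) * a j) := by
  classical
  ext p
  rw [illuminate_apply, ofPoints, Finsupp.finsetSum_apply, Finsupp.finsetSum_apply, mul_sum]
  refine sum_congr rfl fun j _ => ?_
  rw [Finsupp.single_apply, Finsupp.single_apply]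
  split_ifs with h
  · rw [h]
  · simp

lemma support_ofPoints_subset {n : ℕ} (y : Fin n → Plane) (a : Fin n → ℂ) :
    ((ofPoints y a).support : Set Plane) ⊆ Set.range y := by
  classical
  intro p hp
  by_contra h
  refine Finsupp.mem_support_iff.1 (Finset.mem_coe.1 hp) ?_
  rw [ofPoints, Finsupp.finsetSum_apply]
  refine sum_eq_zero fun j _ => Finsupp.single_eq_of_ne fun hj => h ⟨j, hj.symm⟩

lemma l0_ofPoints_le {n : ℕ} (y : Fin n → Plane) (a : Fin n → ℂ) : l0 (ofPoints y a) ≤ n := by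
  classical
  have h : (ofPoints y a).support ⊆ univ.image y := fun p hp => by
    obtain ⟨j, hj⟩ := support_ofPoints_subset y a (Finset.mem_coe.2 hp)
    exact mem_image.2 ⟨j, mem_univ _, hj⟩
  calc l0 (ofPoints y a) ≤ (univ.image y).card := card_le_card h
    _ ≤ (univ : Finset (Fin n)).card := card_image_le
    _ = n := by simp

lemma norm_lt_of_supNorm_lt {Ω σ : ℝ} {f : Plane → ℂ} (h : supNorm Ω f < ENNReal.ofReal σ)
    {ω : Plane} (hω : ω ∈ Metric.closedBall (0 : Plane) Ω) : ‖f ω‖ < σ := by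
  have h1 : ‖f ω‖ₑ < ENNReal.ofReal σ :=
    (le_iSup₂ (f := fun ω (_ : ω ∈ Metric.closedBall (0 : Plane) Ω) => ‖f ω‖ₑ) ω hω).trans_lt h
  rw [← ofReal_norm] at h1
  exact (ENNReal.ofReal_lt_ofReal_iff_of_nonneg (norm_nonneg _)).1 h1

lemma supNorm_congr_norm {Ω : ℝ} {f g : Plane → ℂ}
    (h : ∀ ω ∈ Metric.closedBall (0 : Plane) Ω, ‖f ω‖ = ‖g ω‖) : supNorm Ω f = supNorm Ω g := by
  refine iSup_congr fun ω => iSup_congr fun hω => ?_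
  rw [← ofReal_norm, ← ofReal_norm, h ω hω]

/-! ### Annihilating sine modulations -/

/-- Multiplying the amplitudes by `sin (v · (p - z))` averages two translates of the Fourier
transform by `± v`. -/
lemma norm_modulated_lt {B : ℝ} (δ : DiscreteMeasure) (w : Plane → ℂ) (v z ω : Plane)
    (hp : ‖Finsupp.linearCombination ℂ (fun p : Plane =>
      w p * Complex.exp (Complex.I * ((inner ℝ p (ω + v) : ℝ) : ℂ))) δ‖ < B)
    (hm : ‖Finsupp.linearCombination ℂ (fun p : Plane =>
      w p * Complex.exp (Complex.I * ((inner ℝ p (ω - v) : ℝ) : ℂ))) δ‖ < B) :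
    ‖Finsupp.linearCombination ℂ (fun p : Plane =>
      (((Real.sin (inner ℝ v (p - z)) : ℝ) : ℂ) * w p) *
        Complex.exp (Complex.I * ((inner ℝ p ω : ℝ) : ℂ))) δ‖ < B := by
  set P := Finsupp.linearCombination ℂ (fun p : Plane =>
      w p * Complex.exp (Complex.I * ((inner ℝ p (ω + v) : ℝ) : ℂ))) δ with hP
  set M := Finsupp.linearCombination ℂ (fun p : Plane =>
      w p * Complex.exp (Complex.I * ((inner ℝ p (ω - v) : ℝ) : ℂ))) δ with hM
  -- The unimodular phases `u`, `u'` move the zero of the sine from the origin to `z`.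
  set u : ℂ := Complex.exp (((inner ℝ v z : ℝ) : ℂ) * Complex.I) with hu
  set u' : ℂ := Complex.exp (((-inner ℝ v z : ℝ) : ℂ) * Complex.I) with hu'
  have key : Finsupp.linearCombination ℂ (fun p : Plane =>
      (((Real.sin (inner ℝ v (p - z)) : ℝ) : ℂ) * w p) *
        Complex.exp (Complex.I * ((inner ℝ p ω : ℝ) : ℂ))) δ
      = (Complex.I / 2) * (u * M - u' * P) := by
    rw [hP, hM, Finsupp.linearCombination_apply, Finsupp.linearCombination_apply,
      Finsupp.linearCombination_apply, Finsupp.sum, Finsupp.sum, Finsupp.sum, mul_sum, mul_sum,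
      ← sum_sub_distrib, mul_sum]
    refine sum_congr rfl fun p _ => ?_
    have e1 : u * Complex.exp (Complex.I * ((inner ℝ p (ω - v) : ℝ) : ℂ))
        = Complex.exp (-((inner ℝ v (p - z) : ℝ) : ℂ) * Complex.I) *
          Complex.exp (Complex.I * ((inner ℝ p ω : ℝ) : ℂ)) := by
      rw [hu, ← Complex.exp_add, ← Complex.exp_add, inner_sub_right, inner_sub_right,
        real_inner_comm p v]
      push_cast
      ring_nf
    have e2 : u' * Complex.exp (Complex.I * ((inner ℝ p (ω + v) : ℝ) : ℂ))
        = Complex.exp (((inner ℝ v (p - z) : ℝ) : ℂ) * Complex.I) *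
          Complex.exp (Complex.I * ((inner ℝ p ω : ℝ) : ℂ)) := by
      rw [hu', ← Complex.exp_add, ← Complex.exp_add, inner_sub_right, inner_add_right,
        real_inner_comm p v]
      push_cast
      ring_nf
    simp only [smul_eq_mul]
    rw [Complex.ofReal_sin, Complex.sin]
    linear_combination (-(Complex.I / 2) * δ p * w p) * e1 + (Complex.I / 2) * δ p * w p * e2
  have nu : ‖u‖ = 1 := Complex.norm_exp_ofReal_mul_I _
  have nu' : ‖u'‖ = 1 := Complex.norm_exp_ofReal_mul_I _
  rw [key, norm_mul]
  have h1 : ‖u * M - u' * P‖ ≤ ‖M‖ + ‖P‖ := by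
    refine (norm_sub_le _ _).trans_eq ?_
    rw [norm_mul, norm_mul, nu, nu', one_mul, one_mul]
  have h2 : ‖Complex.I / 2‖ = 1 / 2 := by simp
  rw [h2]
  linarith

/-- A bound for the Fourier transform on a ball passes to sine-product modulations whose
frequencies fit into the ball. -/
lemma norm_prod_sin_modulated_lt {Ω B : ℝ} (δ : DiscreteMeasure)
    (hδ : ∀ ω ∈ Metric.closedBall (0 : Plane) Ω, ‖fourierData δ ω‖ < B)
    (v : Plane → Plane) (S : Finset Plane) :
    ∀ ω : Plane, ‖ω‖ + ∑ z ∈ S, ‖v z‖ ≤ Ω →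
      ‖Finsupp.linearCombination ℂ (fun p : Plane =>
        (∏ z ∈ S, ((Real.sin (inner ℝ (v z) (p - z)) : ℝ) : ℂ)) *
          Complex.exp (Complex.I * ((inner ℝ p ω : ℝ) : ℂ))) δ‖ < B := by
  classical
  induction S using Finset.induction_on with
  | empty =>
    intro ω hω
    simp only [sum_empty, add_zero] at hω
    simp only [prod_empty, one_mul]
    rw [← fourierData_eq_linearCombination]
    exact hδ ω (by simpa using hω)
  | insert z S hz ih =>
    intro ω hω
    rw [sum_insert hz] at hω
    simp only [prod_insert hz]
    -- Translating by `± v z` costs at most `‖v z‖` of the remaining radius.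
    refine norm_modulated_lt δ _ (v z) z ω (ih _ ?_) (ih _ ?_)
    · linarith [norm_add_le ω (v z)]
    · linarith [norm_sub_le ω (v z)]

/-- A frequency of norm at most `R` that detects the vector `u`. -/
lemma exists_frequency {R : ℝ} (hR : 0 < R) (u : Plane) :
    ∃ v : Plane, ‖v‖ ≤ R ∧ min (2 / Real.pi * (R * ‖u‖)) 1 ≤ Real.sin (inner ℝ v u) := by
  have hπ := Real.pi_pos
  rcases eq_or_ne u 0 with rfl | hu
  · exact ⟨0, by simpa using hR.le, by simp⟩
  have hu' : 0 < ‖u‖ := norm_pos_iff.2 hu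
  -- The cap keeps the phase `r * ‖u‖` in `[0, π/2]`, where Jordan's inequality `sin t ≥ 2 t / π`
  -- holds; when it is active the sine equals 1.
  set r : ℝ := min R (Real.pi / 2 / ‖u‖) with hr
  have hr0 : 0 < r := lt_min hR (by positivity)
  refine ⟨(r / ‖u‖) • u, ?_, ?_⟩
  · rw [norm_smul, Real.norm_of_nonneg (by positivity), div_mul_cancel₀ _ hu'.ne']
    exact min_le_left _ _
  · have hin : inner ℝ ((r / ‖u‖) • u) u = r * ‖u‖ := by
      rw [real_inner_smul_left, real_inner_self_eq_norm_sq]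
      field_simp
    have hle : r * ‖u‖ ≤ Real.pi / 2 := by
      rw [← le_div_iff₀ hu']
      exact min_le_right _ _
    rw [hin]
    refine le_trans ?_ (Real.mul_le_sin (by positivity) hle)
    rcases min_choice R (Real.pi / 2 / ‖u‖) with h | h
    · rw [hr, h]
      exact min_le_left _ _
    · rw [hr, h]
      refine (min_le_right _ _).trans_eq ?_
      field_simp

/-! ### Stability constant, amplitudes and separation -/

/-- Homogeneity: rescale `x` to norm 1. Only the lower-bound property of the infimum is needed, not
that it is attained. -/
lemma sigmaInftyMin_mul_norm_le {m k : ℕ} (A : Matrix (Fin m) (Fin k) ℂ) (x : Fin k → ℂ) :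
    sigmaInftyMin A * ‖x‖ ≤ ‖A.mulVec x‖ := by
  rcases eq_or_ne x 0 with rfl | hx
  · simp
  have hx' : 0 < ‖x‖ := norm_pos_iff.2 hx
  have h : sigmaInftyMin A ≤ ‖A.mulVec (((‖x‖⁻¹ : ℝ) : ℂ) • x)‖ := by
    refine csInf_le ⟨0, ?_⟩ ⟨((‖x‖⁻¹ : ℝ) : ℂ) • x, ?_, rfl⟩
    · rintro _ ⟨x, _, rfl⟩
      exact norm_nonneg _
    · simp [norm_smul, hx'.ne']
  rw [Matrix.mulVec_smul, norm_smul, Complex.norm_real, norm_inv, norm_norm] at h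
  calc sigmaInftyMin A * ‖x‖ ≤ ‖x‖⁻¹ * ‖A.mulVec x‖ * ‖x‖ := by gcongr
    _ = ‖A.mulVec x‖ := by field_simp

/-- Positivity of the constant thus forces at least one measurement, and the noise bound then gives
`σ > 0`. -/
lemma sigmaInftyMin_of_isEmpty {k : ℕ} (hk : 0 < k) (A : Matrix (Fin 0) (Fin k) ℂ) :
    sigmaInftyMin A ≤ 0 := by
  have : Nonempty (Fin k) := ⟨⟨0, hk⟩⟩
  have h := sigmaInftyMin_mul_norm_le A (fun _ => 1)
  have h1 : ‖A.mulVec (fun _ => 1)‖ = 0 := by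
    rw [norm_eq_zero]
    exact Subsingleton.elim _ _
  rw [h1, pi_norm_const] at h
  simpa using h

lemma mMin_le {n : ℕ} (a : Fin n → ℂ) (j : Fin n) : mMin a ≤ ‖a j‖ :=
  ciInf_le (Set.finite_range _).bddBelow j

lemma mMin_pos {n : ℕ} (hn : 0 < n) {a : Fin n → ℂ} (ha : ∀ j, a j ≠ 0) : 0 < mMin a := by
  have : Nonempty (Fin n) := ⟨⟨0, hn⟩⟩
  obtain ⟨j, hj⟩ := exists_eq_ciInf_of_finite (f := fun j => ‖a j‖)
  rw [mMin, ← hj]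
  exact norm_pos_iff.2 (ha j)

lemma dMin_le {n : ℕ} (y : Fin n → Plane) {i j : Fin n} (h : i ≠ j) :
    dMin y ≤ dist (y i) (y j) :=
  ciInf_le (f := fun p : {p : Fin n × Fin n // p.1 ≠ p.2} => dist (y p.1.1) (y p.1.2))
    (Set.finite_range _).bddBelow ⟨(i, j), h⟩

lemma dMin_pos {n : ℕ} (hn : 2 ≤ n) {y : Fin n → Plane} (hy : Function.Injective y) :
    0 < dMin y := by
  have : Nonempty {p : Fin n × Fin n // p.1 ≠ p.2} :=
    ⟨⟨(⟨0, by omega⟩, ⟨1, by omega⟩), by simp⟩⟩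
  obtain ⟨p, hp⟩ := exists_eq_ciInf_of_finite
    (f := fun p : {p : Fin n × Fin n // p.1 ≠ p.2} => dist (y p.1.1) (y p.1.2))
  rw [dMin, ← hp]
  exact dist_pos.2 (hy.ne p.2)

/-! ### From close data to close supports -/

/-- Two illuminated measures whose Fourier data are `2σ`-close for all patterns have close
supports, in a product sense. -/
lemma prod_min_dist_lt {n T : ℕ} (hn : 0 < n) {Ω σ : ℝ} (hΩ : 0 < Ω) (hσ : 0 < σ)
    {y : Fin n → Plane} {a : Fin n → ℂ} (ha : ∀ j, a j ≠ 0)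
    {J Jhat : Fin T → Plane → ℂ} (hJ : 0 < sigmaInftyMin (illuminationMatrix J y))
    {ρ : DiscreteMeasure} (hρ : l0 ρ ≤ n)
    (hclose : ∀ t, ∀ ω ∈ Metric.closedBall (0 : Plane) Ω,
      ‖fourierData (illuminate (J t) (ofPoints y a)) ω - fourierData (illuminate (Jhat t) ρ) ω‖
        < 2 * σ) (j : Fin n) :
    ∏ z ∈ ρ.support, min (2 / Real.pi * (Ω / n * ‖y j - z‖)) 1 <
      2 * (1 / sigmaInftyMin (illuminationMatrix J y) * (σ / mMin a)) := by
  have hn' : (0 : ℝ) < n := by exact_mod_cast hn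
  have hπ := Real.pi_pos
  choose v hv1 hv2 using fun z : Plane => exists_frequency (div_pos hΩ hn') (y j - z)
  set w : Plane → ℂ := fun p =>
    ∏ z ∈ ρ.support, ((Real.sin (inner ℝ (v z) (p - z)) : ℝ) : ℂ) with hw
  have hsum : ∑ z ∈ ρ.support, ‖v z‖ ≤ Ω := by
    calc ∑ z ∈ ρ.support, ‖v z‖ ≤ ∑ _z ∈ ρ.support, Ω / n := sum_le_sum fun z _ => hv1 z
      _ = (l0 ρ : ℝ) * (Ω / n) := by rw [sum_const, nsmul_eq_mul, l0]
      _ ≤ n * (Ω / n) := by gcongr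
      _ = Ω := by field_simp
  have hmod : ∀ t, ‖∑ i, J t (y i) * (a i * w (y i))‖ < 2 * σ := by
    intro t
    -- Evaluation at frequency 0 leaves the whole radius `Ω` for the modulations.
    have h := norm_prod_sin_modulated_lt (Ω := Ω) (B := 2 * σ)
      (illuminate (J t) (ofPoints y a) - illuminate (Jhat t) ρ)
      (fun ω hω => by
        have := hclose t ω hω
        rwa [fourierData_eq_linearCombination, fourierData_eq_linearCombination, ← map_sub,
          ← fourierData_eq_linearCombination] at this)
      v ρ.support 0 (by simpa using hsum)
    have h0 : Finsupp.linearCombination ℂ (fun p : Plane => w p *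
        Complex.exp (Complex.I * ((inner ℝ p (0 : Plane) : ℝ) : ℂ)))
        (illuminate (Jhat t) ρ) = 0 := by
      rw [Finsupp.linearCombination_apply, Finsupp.sum]
      refine sum_eq_zero fun p hp => ?_
      have hp' : p ∈ ρ.support := by
        rw [Finsupp.mem_support_iff, illuminate_apply] at hp
        exact Finsupp.mem_support_iff.2 (right_ne_zero_of_mul hp)
      have : w p = 0 := prod_eq_zero hp' (by simp)
      rw [this, zero_mul, smul_zero]
    rw [map_sub, h0, sub_zero, illuminate_ofPoints, map_sum] at h
    refine lt_of_eq_of_lt (congrArg _ (sum_congr rfl fun i _ => ?_)) h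
    rw [Finsupp.linearCombination_single]
    simp [hw, mul_assoc]
  set x : Fin n → ℂ := fun i => a i * w (y i) with hx
  have hAx : ‖(illuminationMatrix J y).mulVec x‖ < 2 * σ := by
    rw [pi_norm_lt_iff (by positivity)]
    intro t
    simpa [Matrix.mulVec, dotProduct, illuminationMatrix] using hmod t
  have h1 := (sigmaInftyMin_mul_norm_le (illuminationMatrix J y) x).trans_lt hAx
  have hm := mMin_pos hn ha
  have hprod : ∏ z ∈ ρ.support, min (2 / Real.pi * (Ω / n * ‖y j - z‖)) 1 ≤ ‖w (y j)‖ := by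
    rw [hw]
    simp only [norm_prod, Complex.norm_real]
    refine prod_le_prod (fun z _ => le_min (by positivity) zero_le_one) fun z _ => ?_
    exact (hv2 z).trans (Real.le_norm_self _)
  have h2 : mMin a * ‖w (y j)‖ ≤ ‖x‖ :=
    calc mMin a * ‖w (y j)‖ ≤ ‖a j‖ * ‖w (y j)‖ := by gcongr; exact mMin_le a j
      _ = ‖x j‖ := by rw [hx, norm_mul]
      _ ≤ ‖x‖ := norm_le_pi_norm x j
  set s := sigmaInftyMin (illuminationMatrix J y)
  have h3 : s * (mMin a * ‖w (y j)‖) < 2 * σ := lt_of_le_of_lt (by gcongr) h1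
  refine hprod.trans_lt ?_
  have h4 : 2 * (1 / s * (σ / mMin a)) = 2 * σ / (s * mMin a) := by field_simp
  rw [h4, lt_div_iff₀ (by positivity)]
  linarith

/-- If each `y j` is `z`-close in the product sense at a noise level that is small compared with
the separation, then the finite set of the `z` is a perturbation of the `y`. -/
lemma exists_matching {n : ℕ} {κ d x ε : ℝ} (hκ : 0 < κ)
    (hx0 : 0 < x) (hx1 : x ≤ 1) (hxd : x ≤ κ * (d / 2)) (hε : 2 * ε < x ^ n)
    {y : Fin n → Plane} (hy : ∀ i j, i ≠ j → d ≤ dist (y i) (y j))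
    {S : Finset Plane} (hS : S.card ≤ n)
    (h : ∀ j, ∏ z ∈ S, min (κ * ‖y j - z‖) 1 < 2 * ε) :
    S.card = n ∧ ∃ yhat : Fin n → Plane, Function.Injective yhat ∧ Set.range yhat = S ∧
      ∀ j, ‖yhat j - y j‖ < d / 2 ∧ κ * ‖yhat j - y j‖ * x ^ (n - 1) < 2 * ε := by
  classical
  -- `x` is a uniform lower bound for the factor of any atom at distance at least `d / 2`.
  have hfar : ∀ u : Plane, d / 2 ≤ ‖u‖ → x ≤ min (κ * ‖u‖) 1 := fun u hu =>
    le_min (hxd.trans (by gcongr)) hx1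
  have hnear : ∀ j, ∃ z ∈ S, ‖y j - z‖ < d / 2 := by
    intro j
    by_contra! hc
    have h1 : x ^ n ≤ ∏ z ∈ S, min (κ * ‖y j - z‖) 1 :=
      calc x ^ n ≤ x ^ S.card := pow_le_pow_of_le_one hx0.le hx1 hS
        _ = ∏ _z ∈ S, x := by rw [prod_const]
        _ ≤ _ := prod_le_prod (fun _ _ => hx0.le) fun z hz => hfar _ (hc z hz)
    linarith [h j]
  choose yhat hmem hclose using hnear
  have hinj : Function.Injective yhat := by
    intro i j hij
    by_contra hne
    have h1 := hclose i
    have h2 := hclose j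
    rw [hij] at h1
    have h3 := hy i j hne
    have h4 := dist_triangle_right (y i) (y j) (yhat j)
    rw [dist_eq_norm (y i) (yhat j), dist_eq_norm (y j) (yhat j)] at h4
    linarith
  have himg : univ.image yhat = S := by
    refine eq_of_subset_of_card_le (fun z hz => ?_) ?_
    · obtain ⟨j, -, rfl⟩ := mem_image.1 hz
      exact hmem j
    · rw [card_image_of_injective _ hinj]
      simpa using hS
  refine ⟨?_, yhat, hinj, ?_, fun j => ⟨?_, ?_⟩⟩
  · rw [← himg, card_image_of_injective _ hinj]
    simp
  · rw [← himg]
    simp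
  · rw [norm_sub_rev]
    exact hclose j
  · have hj := h j
    rw [← himg, prod_image fun i _ k _ hik => hinj hik, ← mul_prod_erase _ _ (mem_univ j)] at hj
    have h1 : x ^ (n - 1) ≤ ∏ i ∈ univ.erase j, min (κ * ‖y j - yhat i‖) 1 :=
      calc x ^ (n - 1) = ∏ _i ∈ univ.erase j, x := by
            rw [prod_const, card_erase_of_mem (mem_univ j)]; simp
        _ ≤ _ := prod_le_prod (fun _ _ => hx0.le) fun i hi => hfar _ (by
            have h2 := hy j i (ne_of_mem_erase hi).symm
            have h3 := dist_triangle_right (y j) (y i) (yhat i)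
            rw [dist_eq_norm (y j) (yhat i), dist_eq_norm (y i) (yhat i)] at h3
            linarith [hclose i])
    have h2 : min (κ * ‖y j - yhat j‖) 1 * x ^ (n - 1) < 2 * ε :=
      lt_of_le_of_lt (by gcongr) hj
    rw [norm_sub_rev]
    -- If the minimum were 1, then `x ^ (n - 1) < 2 * ε < x ^ n`, impossible for `x ≤ 1`.
    rcases min_choice (κ * ‖y j - yhat j‖) 1 with hmin | hmin
    · rwa [hmin] at h2
    · rw [hmin, one_mul] at h2
      have : x ^ n ≤ x ^ (n - 1) := pow_le_pow_of_le_one hx0.le hx1 (Nat.sub_le _ _)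
      linarith

/-! ### Numerical constants -/

/-- The separation condition bounds the noise level by a power of the separation. -/
lemma two_mul_lt_pow_of_separation {n : ℕ} (hn : 2 ≤ n) {Ω c₀ d ε : ℝ} (hΩ : 0 < Ω)
    (hc₀ : 1 ≤ c₀) (hε : 0 < ε)
    (hsep : 2.2 * c₀ * Real.exp 1 * Real.pi * ((n : ℝ) + 2) * ((n : ℝ) + 1) / Ω *
      ε ^ (1 / (n : ℝ)) ≤ d) :
    2 * ε < (Ω * d / (2 * Real.pi * c₀ * n)) ^ n := by
  have hn' : (2 : ℝ) ≤ n := by exact_mod_cast hn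
  have hπ := Real.pi_pos
  have hc : 0 < c₀ := by linarith
  set η : ℝ := ε ^ (1 / (n : ℝ)) with hη
  have hη0 : 0 < η := Real.rpow_pos_of_pos hε _
  have hηn : η ^ n = ε := by
    rw [hη, one_div, Real.rpow_inv_natCast_pow hε.le (by omega)]
  set x := Ω * d / (2 * Real.pi * c₀ * n) with hx
  have hx2 : 2 * η ≤ x := by
    rw [hx, le_div_iff₀ (by positivity)]
    have h1 : 2.2 * c₀ * Real.exp 1 * Real.pi * ((n : ℝ) + 2) * ((n : ℝ) + 1) * η ≤ Ω * d := by
      calc _ = Ω * (2.2 * c₀ * Real.exp 1 * Real.pi * ((n : ℝ) + 2) * ((n : ℝ) + 1) / Ω * η) := by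
            field_simp
        _ ≤ Ω * d := by gcongr
    -- The separation constant is generous: this crude inequality is all that is used of it.
    have h2 : 4 * (n : ℝ) ≤ 2.2 * Real.exp 1 * ((n : ℝ) + 2) * ((n : ℝ) + 1) := by
      have he : 2 ≤ Real.exp 1 := by linarith [Real.add_one_le_exp (1 : ℝ)]
      calc 4 * (n : ℝ) ≤ 2.2 * 2 * ((n : ℝ) + 2) * ((n : ℝ) + 1) := by nlinarith
        _ ≤ _ := by gcongr
    calc 2 * η * (2 * Real.pi * c₀ * n) = Real.pi * c₀ * η * (4 * n) := by ring
      _ ≤ Real.pi * c₀ * η * (2.2 * Real.exp 1 * ((n : ℝ) + 2) * ((n : ℝ) + 1)) := by gcongr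
      _ ≤ Ω * d := by linarith
  -- Strictness comes from `2 < 2 ^ n`, where `n ≥ 2` enters.
  calc 2 * ε = 2 * η ^ n := by rw [hηn]
    _ < 2 ^ n * η ^ n := by
        have : (2 : ℝ) ^ 1 < 2 ^ n := pow_lt_pow_right₀ (by norm_num) (by omega)
        gcongr
        simpa using this
    _ = (2 * η) ^ n := by rw [mul_pow]
    _ ≤ x ^ n := by gcongr

/-- The argument yields the left side as its constant; each of its factors is absorbed by a factor
of `constC`. -/
lemma pi_mul_le_constC {n : ℕ} (hn : 2 ≤ n) {c₀ : ℝ} (hc₀ : 1 ≤ c₀) :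
    Real.pi * n * (2 * n * c₀) ^ (n - 1) ≤ constC n c₀ := by
  have hn' : (2 : ℝ) ≤ n := by exact_mod_cast hn
  have hπ := Real.pi_pos
  have hc : 0 < c₀ := by linarith
  have h1 : Real.pi ≤ ((n : ℝ) + 2) ^ n :=
    calc Real.pi ≤ 4 := Real.pi_le_four
      _ ≤ (n : ℝ) + 2 := by linarith
      _ = ((n : ℝ) + 2) ^ 1 := (pow_one _).symm
      _ ≤ ((n : ℝ) + 2) ^ n := pow_le_pow_right₀ (by linarith) (by omega)
  have h2 : (2 * (n : ℝ)) ^ (n - 1) ≤ (((n : ℝ) + 1) * Real.exp 1) ^ n := by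
    have he : 2 ≤ Real.exp 1 := by linarith [Real.add_one_le_exp (1 : ℝ)]
    calc (2 * (n : ℝ)) ^ (n - 1) ≤ (2 * (n : ℝ)) ^ n :=
          pow_le_pow_right₀ (by linarith) (Nat.sub_le _ _)
      _ ≤ (((n : ℝ) + 1) * Real.exp 1) ^ n := by
          refine pow_le_pow_left₀ (by positivity) ?_ n
          nlinarith
  have h3 : 1 ≤ Real.sqrt (2 * Real.pi) := by
    rw [Real.one_le_sqrt]
    linarith [Real.pi_gt_three]
  calc Real.pi * n * (2 * n * c₀) ^ (n - 1)
      = Real.pi * (2 * (n : ℝ)) ^ (n - 1) * 1 * (n * c₀ ^ (n - 1)) := by rw [mul_pow]; ring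
    _ ≤ ((n : ℝ) + 2) ^ n * (((n : ℝ) + 1) * Real.exp 1) ^ n * Real.sqrt (2 * Real.pi) *
        (n * c₀ ^ (n - 1)) := by gcongr
    _ = constC n c₀ := by rw [constC, mul_pow]; ring

/-! ### Feasibility and conclusion -/

/-- The true measure is feasible for the true patterns. -/
lemma ofPoints_mem_feasible {n T : ℕ} {Ω σ : ℝ} {O : Set Plane} {y : Fin n → Plane}
    {a : Fin n → ℂ} (hyO : ∀ j, y j ∈ O) {J W Y : Fin T → Plane → ℂ}
    (hW : ∀ t, supNorm Ω (W t) < ENNReal.ofReal σ)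
    (hY : ∀ t, ∀ ω ∈ Metric.closedBall (0 : Plane) Ω,
      Y t ω = fourierData (illuminate (J t) (ofPoints y a)) ω + W t ω) :
    ofPoints y a ∈ feasible Ω σ O Y J := by
  refine ⟨(support_ofPoints_subset y a).trans (Set.range_subset_iff.2 hyO), fun t => ?_⟩
  refine lt_of_eq_of_lt (supNorm_congr_norm fun ω hω => ?_) (hW t)
  rw [hY t ω hω, sub_add_cancel_left, norm_neg]

/-- Solutions of each of the three problems are feasible for some patterns and have at most `n`
masses. -/
lemma exists_feasible_of_solves {n T : ℕ} {Ω σ : ℝ} {O : Set Plane} {y : Fin n → Plane}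
    {a : Fin n → ℂ} {J Y : Fin T → Plane → ℂ} (hμ : ofPoints y a ∈ feasible Ω σ O Y J)
    {ρ : DiscreteMeasure}
    (hρ : SolvesKnown Ω σ O Y J ρ ∨
      (∃ Jhat : Fin T → Plane → ℂ, SolvesApprox n Ω σ O Y Jhat ρ) ∨
      SolvesUnknown Ω σ O Y ρ) :
    l0 ρ ≤ n ∧ ∃ Jhat : Fin T → Plane → ℂ, ρ ∈ feasible Ω σ O Y Jhat := by
  rcases hρ with h | ⟨Jhat, ⟨ρ', hρ', hl⟩, h⟩ | h
  · exact ⟨(h.2 _ hμ).trans (l0_ofPoints_le y a), J, h.1⟩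
  · exact ⟨(h.2 _ hρ').trans_eq hl, Jhat, h.1⟩
  · exact ⟨(h.2 _ ⟨J, hμ⟩).trans (l0_ofPoints_le y a), h.1⟩

end MultiIllum

theorem theorem3p1
    (n T : ℕ) (hn : 2 ≤ n) (Ω σ c₀ : ℝ) (hΩ : 0 < Ω) (hc₀ : 1 ≤ c₀)
    -- the disk
    (center : Plane) (O : Set Plane)
    (hO : O = Metric.closedBall center (c₀ * n * Real.pi / Ω))
    -- the `n`-sparse measure
    (y : Fin n → Plane) (a : Fin n → ℂ) (hy : Function.Injective y) (ha : ∀ j, a j ≠ 0)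
    (hyO : ∀ j, y j ∈ O)
    -- illumination patterns, noise and measurements
    (J W Y : Fin T → Plane → ℂ)
    (hW : ∀ t, supNorm Ω (W t) < ENNReal.ofReal σ)
    (hY : ∀ t, ∀ ω ∈ Metric.closedBall (0 : Plane) Ω,
      Y t ω = fourierData (illuminate (J t) (ofPoints y a)) ω + W t ω)
    (hJ : 0 < sigmaInftyMin (illuminationMatrix J y))
    -- the separation condition
    (hsep : 2.2 * c₀ * Real.exp 1 * Real.pi * ((n : ℝ) + 2) * ((n : ℝ) + 1) / Ω *
      (1 / sigmaInftyMin (illuminationMatrix J y) * (σ / mMin a)) ^ (1 / (n : ℝ)) ≤ dMin y)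
    -- a solution of one of the three problems
    (ρ : DiscreteMeasure)
    (hρ : SolvesKnown Ω σ O Y J ρ ∨
      (∃ Jhat : Fin T → Plane → ℂ, SolvesApprox n Ω σ O Y Jhat ρ) ∨
      SolvesUnknown Ω σ O Y ρ) :
    l0 ρ = n ∧
    ∃ yhat : Fin n → Plane, Function.Injective yhat ∧
      Set.range yhat = (ρ.support : Set Plane) ∧
      ∀ j, ‖yhat j - y j‖ < dMin y / 2 ∧
        ‖yhat j - y j‖ < constC n c₀ / Ω * srf Ω (dMin y) ^ (n - 1) *
          (1 / sigmaInftyMin (illuminationMatrix J y)) * (σ / mMin a) := by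
  have hπ := Real.pi_pos
  have hn0 : 0 < n := by omega
  have hn' : (0 : ℝ) < n := by exact_mod_cast hn0
  have hc : 0 < c₀ := by linarith
  have hT : 0 < T := by
    rcases Nat.eq_zero_or_pos T with rfl | h
    · exact absurd hJ (sigmaInftyMin_of_isEmpty hn0 _).not_gt
    · exact h
  have hσ : 0 < σ := ENNReal.ofReal_pos.1 (bot_le.trans_lt (hW ⟨0, hT⟩))
  obtain ⟨hl, Jhat, -, hfeas⟩ :=
    exists_feasible_of_solves (ofPoints_mem_feasible hyO hW hY) hρ
  have hprod := prod_min_dist_lt hn0 hΩ hσ ha hJ hl (Jhat := Jhat) (fun t ω hω => by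
    have h1 := norm_lt_of_supNorm_lt (hfeas t) hω
    have h2 := norm_lt_of_supNorm_lt (hW t) hω
    have h3 : fourierData (illuminate (J t) (ofPoints y a)) ω
        - fourierData (illuminate (Jhat t) ρ) ω
        = -(fourierData (illuminate (Jhat t) ρ) ω - Y t ω) - W t ω := by
      rw [hY t ω hω]
      ring
    rw [h3]
    refine (norm_sub_le _ _).trans_lt ?_
    rw [norm_neg]
    linarith)
  have hd := dMin_pos hn hy
  have hm := mMin_pos hn0 ha
  set d := dMin y
  set ε := 1 / sigmaInftyMin (illuminationMatrix J y) * (σ / mMin a) with hεdef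
  have hε : 0 < ε := by positivity
  -- The separation is at most the diameter of the disk; this is what makes `x ≤ 1` below.
  have hdiam : d ≤ 2 * (c₀ * n * Real.pi / Ω) := by
    have h0 := hyO ⟨0, by omega⟩
    have h1 := hyO ⟨1, by omega⟩
    rw [hO, Metric.mem_closedBall] at h0 h1
    have h2 : d ≤ dist (y ⟨0, by omega⟩) (y ⟨1, by omega⟩) := dMin_le y (by simp)
    linarith [dist_triangle_right (y ⟨0, by omega⟩) (y ⟨1, by omega⟩) center]
  set x := Ω * d / (2 * Real.pi * c₀ * n) with hx
  have hx0 : 0 < x := by positivity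
  have hx1 : x ≤ 1 := by
    rw [hx, div_le_one (by positivity)]
    calc Ω * d ≤ Ω * (2 * (c₀ * n * Real.pi / Ω)) := by gcongr
      _ = 2 * Real.pi * c₀ * n := by field_simp
  -- The right side is `2 * c₀` times `x / 2`, so `c₀ ≥ 1` suffices.
  have hxd : x ≤ 2 / Real.pi * (Ω / n) * (d / 2) := by
    rw [hx, div_le_iff₀ (by positivity)]
    have : 2 / Real.pi * (Ω / n) * (d / 2) * (2 * Real.pi * c₀ * n) = 2 * c₀ * (Ω * d) := by
      field_simp
    rw [this]
    nlinarith [mul_pos hΩ hd]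
  obtain ⟨hcard, yhat, hinj, hrange, hclose⟩ := exists_matching
    (κ := 2 / Real.pi * (Ω / n)) (by positivity) hx0 hx1 hxd
    (two_mul_lt_pow_of_separation hn hΩ hc₀ hε hsep) (fun i j hij => dMin_le y hij) hl
    (fun j => by simpa only [mul_assoc] using hprod j)
  refine ⟨hcard, yhat, hinj, hrange, fun j => ⟨(hclose j).1, ?_⟩⟩
  have hj := (hclose j).2
  -- `x` is the reciprocal of `2 * n * c₀ * SRF`, so dividing by `x ^ (n - 1)` produces the power of
  -- the super-resolution factor.
  have hxs : x * (2 * n * c₀ * srf Ω d) = 1 := by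
    rw [hx, srf]
    field_simp
  have hs : 0 < srf Ω d := by
    rw [srf]
    positivity
  have hxp : x ^ (n - 1) * ((2 * n * c₀) ^ (n - 1) * srf Ω d ^ (n - 1)) = 1 := by
    rw [← mul_pow, ← mul_pow, hxs, one_pow]
  set q := (2 * n * c₀) ^ (n - 1) * srf Ω d ^ (n - 1) with hq
  have hq0 : 0 < q := by positivity
  calc ‖yhat j - y j‖
      = Real.pi * n / (2 * Ω) * q *
        (2 / Real.pi * (Ω / n) * ‖yhat j - y j‖ * x ^ (n - 1)) := by
        have : Real.pi * n / (2 * Ω) * q *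
          (2 / Real.pi * (Ω / n) * ‖yhat j - y j‖ * x ^ (n - 1))
          = ‖yhat j - y j‖ * (x ^ (n - 1) * q) := by field_simp
        rw [this, hxp, mul_one]
    _ < Real.pi * n / (2 * Ω) * q * (2 * ε) := by gcongr
    _ = Real.pi * n * (2 * n * c₀) ^ (n - 1) / Ω * srf Ω d ^ (n - 1) * ε := by
        rw [hq]
        field_simp
    _ ≤ constC n c₀ / Ω * srf Ω d ^ (n - 1) * ε := by
        gcongr
        exact pi_mul_le_constC hn hc₀
    _ = _ := by
        rw [hεdef]
        ring
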